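/- Let $G$ be a finite solvable group and let $\chi$ be a faithful irreducible complex character of $G$. Assume that $$\chi\overline{\chi} = 1_G + m_1\alpha_1 + m_2\alpha_2,$$ where $\overline{\chi}$ is the complex conjugate of $\chi$, $1_G$ is the principal character of $G$, $\alpha_1$ and $\alpha_2$ are non-principal irreducible complex characters of $G$, and $m_1, m_2$ are strictly positive integers. Then the order of $G$ is even. -/

import Mathlib

/-- `Irr(G)`: the set of irreducible complex characters of `G`, that is, the functions `G → ℂ`
that are the trace of an irreducible finite-dimensional complex representation of `G`. Every such
representation is isomorphic to one on some `ℂⁿ`, so only these underlying spaces are used. -/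
def Irr (G : Type*) [Group G] : Set (G → ℂ) :=
  {χ | ∃ (n : ℕ) (ρ : Representation ℂ G (Fin n → ℂ)), ρ.IsIrreducible ∧ ρ.character = χ}

/-- The kernel `{g ∈ G | χ(g) = χ(1)}` of a character `χ`. -/
def charKer {G : Type*} [Group G] (χ : G → ℂ) : Set G :=
  {g | χ g = χ 1}

/-- A character is faithful if its kernel is trivial. -/
def IsFaithfulChar {G : Type*} [Group G] (χ : G → ℂ) : Prop :=
  charKer χ = {1}

/-!
The product `χ * conj χ` is the character of `G` acting on `End V` by conjugation, where `V` affords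
`χ`. Let `A₁`, `A₂` afford `α₁`, `α₂`, and let `K` be the intersection of their kernels. As `G` is
solvable and `K ≠ G`, some normal subgroup `E` not contained in `K` has its commutators in `K`
(`exists_normal_commutator_le`); say `E` acts nontrivially on `A₁`. The group `E` acts on `A₁` and
`A₂` through commuting operators, so each of them is the direct sum of weight spaces along a single
`G`-orbit of linear characters of `E` (`iSup_orbit_weightSpace_eq_top`), and this orbit is nontrivial
for `A₁`.

Suppose `|G|` is odd, and let `μ` be a weight of `A₁`. Then `μ⁻¹` is not conjugate to `μ`
(`eq_one_of_inv_mem_orbit`), so it is not a weight of `A₁`. But the weights of `End V` are closed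
under inversion, so `μ⁻¹` is a weight of `A₂`. Therefore the trivial character is a weight of neither
constituent, and it occurs once in `End V`: only scalars commute with `E`. It follows that every
weight of `End V` has multiplicity one (`finrank_weightSpace_linHom_le_one`). Hence `m₁ = m₂ = 1`,
and the degrees of `α₁` and `α₂` are the sizes of the orbits of `μ` and `μ⁻¹`, which are equal and
divide `|G|`. So `χ(1) ^ 2 = 1 + 2 * N` with `N` odd, which is impossible modulo `4`.
-/

open Representation Module

/-! ### Weight spaces -/

section WeightSpaces

variable {E W : Type*} [Group E] [AddCommGroup W] [Module ℂ W]

/-- The simultaneous eigenspace of a representation `σ` of `E` for the linear character `μ`: the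
vectors on which every `e` acts as the scalar `μ e`. -/
def weightSpace (σ : Representation ℂ E W) (μ : E →* ℂˣ) : Submodule ℂ W where
  carrier := {v | ∀ e, σ e v = (μ e : ℂ) • v}
  zero_mem' e := by simp
  add_mem' hv hw e := by rw [map_add, hv e, hw e, smul_add]
  smul_mem' r v hv e := by rw [map_smul, hv e, smul_comm]

theorem mem_weightSpace {σ : Representation ℂ E W} {μ : E →* ℂˣ} {v : W} :
    v ∈ weightSpace σ μ ↔ ∀ e, σ e v = (μ e : ℂ) • v := Iff.rfl

/-- The weight space of `μ` is the space of invariants of the twist of `σ` by `μ⁻¹`, so its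
dimension is the average of `μ⁻¹` times the character of `σ`. -/
theorem finrank_weightSpace [Finite E] [FiniteDimensional ℂ W] (σ : Representation ℂ E W)
    (μ : E →* ℂˣ) [Fintype E] :
    (finrank ℂ (weightSpace σ μ) : ℂ) =
      (Nat.card E : ℂ)⁻¹ * ∑ e, ((μ⁻¹ e : ℂˣ) : ℂ) * σ.character e := by
  let τ : Representation ℂ E W :=
    { toFun := fun e => ((μ⁻¹ e : ℂˣ) : ℂ) • σ e
      map_one' := by simp
      map_mul' := fun x y => by
        rw [map_mul, map_mul, Units.val_mul, smul_mul_smul_comm] }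
  have hτ : ∀ e, τ e = ((μ⁻¹ e : ℂˣ) : ℂ) • σ e := fun _ => rfl
  have hinv : invariants τ = weightSpace σ μ := by
    ext v
    rw [mem_invariants, mem_weightSpace]
    refine forall_congr' fun e => ?_
    rw [hτ, LinearMap.smul_apply, MonoidHom.inv_apply, ← Units.smul_def, inv_smul_eq_iff,
      Units.smul_def]
  have : Invertible (Nat.card E : ℂ) := invertibleOfNonzero (by simp)
  rw [← hinv, ← card_inv_mul_sum_char_eq_finrank]
  simp [character, hτ]

theorem weightSpace_le_iInf_maxGenEigenspace (σ : Representation ℂ E W) (μ : E →* ℂˣ) :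
    weightSpace σ μ ≤ ⨅ e, End.maxGenEigenspace (σ e) (μ e : ℂ) := by
  intro v hv
  rw [Submodule.mem_iInf]
  intro e
  exact (End.eigenspace_le_maxGenEigenspace (R := ℂ)) (End.mem_eigenspace_iff.mpr (hv e))

theorem iSupIndep_weightSpace {σ : Representation ℂ E W} (hσ : ∀ x y, Commute (σ x) (σ y)) :
    iSupIndep (weightSpace σ) := by
  have h := End.independent_iInf_maxGenEigenspace_of_forall_mapsTo (fun e => σ e)
    (fun i j φ => End.mapsTo_maxGenEigenspace_of_comm (hσ j i) φ)
  refine (h.comp (f := fun μ : E →* ℂˣ => fun e => (μ e : ℂ)) ?_).mono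
    (weightSpace_le_iInf_maxGenEigenspace σ)
  intro μ ν h
  ext e
  exact congrFun h e

theorem exists_weightSpace_ne_bot [Finite E] [FiniteDimensional ℂ W] [Nontrivial W]
    {σ : Representation ℂ E W} (hσ : ∀ x y, Commute (σ x) (σ y)) :
    ∃ μ, weightSpace σ μ ≠ ⊥ := by
  have htop := End.iSup_iInf_maxGenEigenspace_eq_top_of_iSup_maxGenEigenspace_eq_top_of_commute
    (fun e => σ e) (fun x y _ => hσ x y) (fun e => End.iSup_maxGenEigenspace_eq_top _)
  -- a common generalized eigenvector of the operators, which is an eigenvector as they are semisimple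
  obtain ⟨c, hc⟩ : ∃ c : E → ℂ, ⨅ e, End.maxGenEigenspace (σ e) (c e) ≠ ⊥ := by
    by_contra! h
    simp [h] at htop
  obtain ⟨v, hv, hv0⟩ := Submodule.exists_mem_ne_zero_of_ne_bot hc
  have hv' : ∀ e, σ e v = c e • v := by
    intro e
    have hss : End.IsSemisimple (σ e) := by
      refine End.isSemisimple_of_squarefree_aeval_eq_zero
        (p := Polynomial.X ^ Nat.card E - Polynomial.C 1) ?_ ?_
      · exact (Polynomial.separable_X_pow_sub_C 1 (by simp [Nat.card_pos.ne'])
          one_ne_zero).squarefree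
      · rw [map_sub, map_pow, Polynomial.aeval_X, map_one, map_one, ← map_pow, pow_card_eq_one',
          map_one, sub_self]
    have := (Submodule.mem_iInf _).mp hv e
    rw [hss.isFinitelySemisimple.maxGenEigenspace_eq_eigenspace] at this
    exact End.mem_eigenspace_iff.mp this
  let c' : E →* ℂ :=
    { toFun := c
      map_one' := by
        have := hv' 1
        rw [map_one, Module.End.one_apply] at this
        exact (smul_left_injective ℂ hv0 (by simpa using this)).symm
      map_mul' := fun x y => by
        apply smul_left_injective ℂ hv0
        change c (x * y) • v = (c x * c y) • v
        rw [← hv', map_mul, Module.End.mul_apply, hv', map_smul, hv', smul_smul, mul_comm] }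
  refine ⟨c'.toHomUnits, (Submodule.ne_bot_iff _).mpr ⟨v, fun e => ?_, hv0⟩⟩
  rw [hv']
  rfl

/-- If only scalars commute with `E`, every weight space of `E` acting on `End W` by conjugation has
dimension at most one. Indeed, for `T ≠ 0` of weight `μ` some `S` of weight `μ⁻¹` has
`trace (T * S) ≠ 0`; products of weights `μ` and `μ⁻¹` commute with `E` and so are scalars, hence
`T` is invertible and any other operator of weight `μ` is a multiple of `T`. -/
theorem finrank_weightSpace_linHom_le_one [Finite E] [FiniteDimensional ℂ W]
    {σ : Representation ℂ E W} (h1 : finrank ℂ (weightSpace (linHom σ σ) 1) = 1)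
    (μ : E →* ℂˣ) : finrank ℂ (weightSpace (linHom σ σ) μ) ≤ 1 := by
  have := Fintype.ofFinite E
  by_cases hbot : weightSpace (linHom σ σ) μ = ⊥
  · rw [hbot, finrank_bot]
    exact zero_le_one
  obtain ⟨T, hT, hT0⟩ := Submodule.exists_mem_ne_zero_of_ne_bot hbot
  have : Nontrivial W := by
    by_contra h
    rw [not_nontrivial_iff_subsingleton] at h
    exact hT0 (Subsingleton.elim _ _)
  -- operators commuting with `E` are scalars
  have hscal : ∀ S ∈ weightSpace (linHom σ σ) 1, ∃ c : ℂ, S = c • (1 : End ℂ W) := by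
    intro S hS
    have hid : (1 : End ℂ W) ∈ weightSpace (linHom σ σ) 1 := by
      intro e
      simp only [linHom_apply, MonoidHom.one_apply, Units.val_one, one_smul]
      change σ e * (1 * σ e⁻¹) = 1
      rw [one_mul, ← map_mul, mul_inv_cancel, map_one]
    obtain ⟨c, hc⟩ := exists_smul_eq_of_finrank_eq_one h1
      (x := ⟨1, hid⟩) (by simp [Subtype.ext_iff]) ⟨S, hS⟩
    exact ⟨c, (congrArg Subtype.val hc).symm⟩
  -- a rank one operator that pairs nontrivially with `T` is averaged into the weight space of `μ⁻¹`
  obtain ⟨v, hv⟩ : ∃ v, T v ≠ 0 := by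
    by_contra! h
    exact hT0 (LinearMap.ext h)
  obtain ⟨φ, hφ⟩ : ∃ φ : Dual ℂ W, φ (T v) ≠ 0 := by
    by_contra! h
    exact hv ((Module.forall_dual_apply_eq_zero_iff ℂ _).mp h)
  have hconj : ∀ {ν : E →* ℂˣ} {R : End ℂ W}, R ∈ weightSpace (linHom σ σ) ν →
      ∀ e, σ e * R * σ e⁻¹ = (ν e : ℂ) • R := by
    intro ν R hR e
    rw [mul_assoc]
    exact hR e
  let S₀ : End ℂ W := φ.smulRight v
  let S : End ℂ W := ∑ e, (μ e : ℂ) • (σ e * S₀ * σ e⁻¹)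
  have hS : ∀ e, σ e * S * σ e⁻¹ = ((μ⁻¹ e : ℂˣ) : ℂ) • S := by
    intro e
    simp only [S, Finset.mul_sum, Finset.sum_mul, Finset.smul_sum]
    refine Fintype.sum_equiv (Equiv.mulLeft e) _ _ fun x => ?_
    simp only [Equiv.coe_mulLeft, map_mul, Units.val_mul, mul_inv_rev, MonoidHom.inv_apply,
      smul_smul, mul_smul_comm, smul_mul_assoc, mul_assoc]
    congr 1
    simp
  have hmem : ∀ R ∈ weightSpace (linHom σ σ) μ, R * S ∈ weightSpace (linHom σ σ) 1 := by
    intro R hR e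
    change σ e * ((R * S) * σ e⁻¹) = _
    have h1 : σ e⁻¹ * σ e = 1 := by rw [← map_mul, inv_mul_cancel, map_one]
    calc σ e * ((R * S) * σ e⁻¹) = σ e * R * (σ e⁻¹ * σ e) * S * σ e⁻¹ := by
          rw [h1]; simp only [mul_assoc, mul_one]
      _ = (σ e * R * σ e⁻¹) * (σ e * S * σ e⁻¹) := by simp only [mul_assoc]
      _ = _ := by
          rw [hconj hR, hS, smul_mul_smul_comm, MonoidHom.inv_apply, Units.mul_inv]
          simp
  have htr : LinearMap.trace ℂ W (T * S) = Nat.card E * φ (T v) := by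
    have h0 : LinearMap.trace ℂ W (T * S₀) = φ (T v) := by
      rw [← contractLeft_apply φ (T v), ← LinearMap.trace_eq_contract_apply]
      congr 1
      ext x
      simp [S₀, dualTensorHom_apply]
    have : ∀ e, LinearMap.trace ℂ W (T * ((μ e : ℂ) • (σ e * S₀ * σ e⁻¹))) = φ (T v) := by
      intro e
      have hT' := hconj hT e⁻¹
      rw [inv_inv, map_inv μ] at hT'
      rw [mul_smul_comm, map_smul, ← mul_assoc, LinearMap.trace_mul_comm, ← mul_assoc,
        ← mul_assoc, hT', smul_mul_assoc, map_smul, h0, smul_smul, Units.mul_inv, one_smul]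
    rw [Finset.mul_sum, map_sum, Finset.sum_congr rfl fun e _ => this e]
    simp [Nat.card_eq_fintype_card]
  obtain ⟨c, hc⟩ := hscal _ (hmem T hT)
  have hc0 : c ≠ 0 := by
    rintro rfl
    rw [hc, zero_smul, map_zero] at htr
    exact mul_ne_zero (by simp) hφ htr.symm
  have hST : S * T = c • 1 := by
    have h : (c⁻¹ • T) * S = 1 := by rw [smul_mul_assoc, hc, inv_smul_smul₀ hc0]
    replace h := mul_eq_one_comm.mp h
    rw [mul_smul_comm] at h
    rw [← h, smul_inv_smul₀ hc0]
  refine finrank_le_one (⟨T, hT⟩ : weightSpace (linHom σ σ) μ) fun ⟨R, hR⟩ => ?_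
  obtain ⟨d, hd⟩ := hscal _ (hmem R hR)
  refine ⟨c⁻¹ * d, Subtype.ext ?_⟩
  change (c⁻¹ * d) • T = R
  have : R * S * T = c • R := by rw [mul_assoc, hST, mul_smul_comm, mul_one]
  rw [hd, smul_mul_assoc, one_mul] at this
  rw [mul_smul, this, inv_smul_smul₀ hc0]

end WeightSpaces

/-! ### Characters at inverses -/

open ComplexConjugate Matrix ComplexOrder in
/-- By averaging, `G` preserves a positive definite Hermitian form `P`, so the matrix of `g⁻¹` is
similar, through `P`, to the conjugate transpose of the matrix of `g`. -/
theorem character_inv_eq_conj {G : Type*} [Group G] [Finite G] {n : ℕ}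
    (ρ : Representation ℂ G (Fin n → ℂ)) (g : G) :
    ρ.character g⁻¹ = conj (ρ.character g) := by
  classical
  have := Fintype.ofFinite G
  let M : G → Matrix (Fin n) (Fin n) ℂ := fun g => LinearMap.toMatrix' (ρ g)
  have hMmul : ∀ x y, M (x * y) = M x * M y := fun x y => by
    simp only [M, map_mul, LinearMap.toMatrix'_mul]
  have hM1 : M 1 = 1 := by simp [M]
  have hch : ∀ x, ρ.character x = (M x).trace := fun x => by
    rw [character, LinearMap.trace_eq_matrix_trace ℂ (Pi.basisFun ℂ (Fin n))]
    rfl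
  -- the Gram matrix of the averaged Hermitian form
  let P := ∑ h, (M h)ᴴ * M h
  have hP : P.PosDef := by
    have : P = 1 + ∑ h ∈ Finset.univ.erase (1 : G), (M h)ᴴ * M h := by
      simp only [P]
      rw [← Finset.add_sum_erase _ (fun h => (M h)ᴴ * M h) (Finset.mem_univ (1 : G)), hM1]
      simp
    rw [this]
    exact Matrix.PosDef.one.add_posSemidef
      (Matrix.posSemidef_sum _ fun h _ => Matrix.posSemidef_conjTranspose_mul_self _)
  have hPg : (M g)ᴴ * P * M g = P := by
    simp only [P, Finset.mul_sum, Finset.sum_mul]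
    refine Fintype.sum_equiv (Equiv.mulRight g) _ _ fun x => ?_
    simp only [Equiv.coe_mulRight, hMmul, Matrix.conjTranspose_mul, Matrix.mul_assoc]
  have hinv : M g * M g⁻¹ = 1 := by rw [← hMmul, mul_inv_cancel, hM1]
  have hu : P⁻¹ * P = 1 := Matrix.nonsing_inv_mul _ ((Matrix.isUnit_iff_isUnit_det _).mp hP.isUnit)
  have h1 : P * M g⁻¹ = (M g)ᴴ * P := by
    calc P * M g⁻¹ = (M g)ᴴ * P * (M g * M g⁻¹) := by rw [← Matrix.mul_assoc, hPg]
      _ = _ := by rw [hinv, Matrix.mul_one]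
  rw [hch, hch, starRingEnd_apply, ← Matrix.trace_conjTranspose]
  calc (M g⁻¹).trace = (P⁻¹ * (P * M g⁻¹)).trace := by rw [← Matrix.mul_assoc, hu, Matrix.one_mul]
    _ = _ := by
      rw [h1, ← Matrix.mul_assoc, Matrix.trace_mul_comm, ← Matrix.mul_assoc,
        mul_eq_one_comm.mp hu, Matrix.one_mul]

/-! ### Weights of a normal subgroup in an irreducible representation -/

section Clifford

open MulAction

theorem eq_top_of_forall_apply_mem {G W : Type*} [Group G] [AddCommGroup W] [Module ℂ W]
    {A : Representation ℂ G W} [A.IsIrreducible] {U : Submodule ℂ W} (hU : U ≠ ⊥)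
    (h : ∀ g, ∀ v ∈ U, A g v ∈ U) : U = ⊤ := by
  rcases eq_bot_or_eq_top (⟨U, fun g v hv => h g v hv⟩ : Subrepresentation A) with h | h
  · exact absurd (congrArg Subrepresentation.toSubmodule h) hU
  · exact congrArg Subrepresentation.toSubmodule h

variable {G W : Type*} [Group G] [AddCommGroup W] [Module ℂ W] {E : Subgroup G} [E.Normal]
  {A : Representation ℂ G W}

/-- `G` permutes the weight spaces of a normal subgroup `E` along its conjugation action on the linear
characters of `E`. That action is the one of `(ConjAct G)ᵈᵐᵃ`, under which `c • μ` sends `e` to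
`μ (c e c⁻¹)`; hence the inverse of `c` in the statement. -/
theorem apply_mem_weightSpace_smul (c : (ConjAct G)ᵈᵐᵃ) {μ : E →* ℂˣ} {v : W}
    (hv : v ∈ weightSpace (A.comp E.subtype) μ) :
    A (ConjAct.ofConjAct (DomMulAct.mk.symm c))⁻¹ v ∈
      weightSpace (A.comp E.subtype) (c • μ) := by
  intro e
  have h := hv (DomMulAct.mk.symm c • e)
  rw [DomMulAct.smul_monoidHom_apply, ← map_smul, ← h]
  simp only [MonoidHom.comp_apply, Subgroup.coe_subtype, ConjAct.Subgroup.val_conj_smul,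
    ConjAct.smul_def, ← Module.End.mul_apply, ← map_mul]
  congr 2
  group

theorem weightSpace_ne_bot_of_mem_orbit {μ ν : E →* ℂˣ}
    (hμ : weightSpace (A.comp E.subtype) μ ≠ ⊥) (hν : ν ∈ orbit (ConjAct G)ᵈᵐᵃ μ) :
    weightSpace (A.comp E.subtype) ν ≠ ⊥ := by
  obtain ⟨c, rfl⟩ := hν
  obtain ⟨v, hv, hv0⟩ := Submodule.exists_mem_ne_zero_of_ne_bot hμ
  refine (Submodule.ne_bot_iff _).mpr ⟨_, apply_mem_weightSpace_smul c hv, fun h => hv0 ?_⟩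
  rw [← A.self_inv_apply (ConjAct.ofConjAct (DomMulAct.mk.symm c)) v, h, map_zero]

/-- The weight spaces along one orbit span a `G`-invariant subspace, which is everything when the
representation is irreducible. This is Clifford's theorem for abelian actions. -/
theorem iSup_orbit_weightSpace_eq_top [A.IsIrreducible] {μ : E →* ℂˣ}
    (hμ : weightSpace (A.comp E.subtype) μ ≠ ⊥) :
    ⨆ ν : orbit (ConjAct G)ᵈᵐᵃ μ, weightSpace (A.comp E.subtype) ν = ⊤ := by
  refine eq_top_of_forall_apply_mem (A := A) ?_ fun g v hv => ?_
  · refine ne_bot_of_le_ne_bot hμ ?_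
    exact le_iSup (fun ν : orbit (ConjAct G)ᵈᵐᵃ μ => weightSpace (A.comp E.subtype) ν)
      ⟨μ, mem_orbit_self μ⟩
  · induction hv using Submodule.iSup_induction' with
    | zero => rw [map_zero]; exact zero_mem _
    | add x y _ _ hx hy => rw [map_add]; exact add_mem hx hy
    | mem ν v hv =>
      let c : (ConjAct G)ᵈᵐᵃ := DomMulAct.mk (ConjAct.toConjAct g⁻¹)
      have h := apply_mem_weightSpace_smul c hv
      have hc : (ConjAct.ofConjAct (DomMulAct.mk.symm c))⁻¹ = g := by simp [c]
      rw [hc] at h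
      exact Submodule.mem_iSup_of_mem
        (p := fun ν : orbit (ConjAct G)ᵈᵐᵃ μ => weightSpace (A.comp E.subtype) ν) (c • ν) h

theorem mem_orbit_of_weightSpace_ne_bot [A.IsIrreducible]
    (hE : ∀ x y : E, Commute (A x) (A y)) {μ ν : E →* ℂˣ}
    (hμ : weightSpace (A.comp E.subtype) μ ≠ ⊥) (hν : weightSpace (A.comp E.subtype) ν ≠ ⊥) :
    ν ∈ orbit (ConjAct G)ᵈᵐᵃ μ := by
  by_contra h
  have hd := iSupIndep_weightSpace (σ := A.comp E.subtype) hE ν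
  refine hν (disjoint_top.mp (hd.mono_right ?_))
  rw [← iSup_orbit_weightSpace_eq_top hμ]
  refine iSup_le fun κ => ?_
  exact le_iSup₂_of_le κ.1 (fun hκ => h (hκ ▸ κ.2)) le_rfl

theorem finrank_eq_ncard_orbit [Finite G] [FiniteDimensional ℂ W] [A.IsIrreducible]
    (hE : ∀ x y : E, Commute (A x) (A y)) {μ : E →* ℂˣ}
    (hμ : weightSpace (A.comp E.subtype) μ ≠ ⊥)
    (h1 : ∀ ν ∈ orbit (ConjAct G)ᵈᵐᵃ μ, finrank ℂ (weightSpace (A.comp E.subtype) ν) = 1) :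
    finrank ℂ W = (orbit (ConjAct G)ᵈᵐᵃ μ).ncard := by
  classical
  have : Finite (ConjAct G)ᵈᵐᵃ := Finite.of_equiv G (ConjAct.toConjAct.toEquiv.trans DomMulAct.mk)
  have : Finite (orbit (ConjAct G)ᵈᵐᵃ μ) := Set.finite_range _
  have := Fintype.ofFinite (orbit (ConjAct G)ᵈᵐᵃ μ)
  have hint := DirectSum.isInternal_submodule_of_iSupIndep_of_iSup_eq_top
    ((iSupIndep_weightSpace (σ := A.comp E.subtype) hE).comp
      (f := ((↑) : orbit (ConjAct G)ᵈᵐᵃ μ → (E →* ℂˣ))) Subtype.val_injective)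
    (iSup_orbit_weightSpace_eq_top hμ)
  have hlin := (LinearEquiv.ofBijective (DirectSum.coeLinearMap _) hint).finrank_eq
  rw [finrank_directSum] at hlin
  rw [← hlin, ← Nat.card_coe_set_eq, Nat.card_eq_fintype_card]
  simp only [Function.comp_apply]
  rw [Finset.sum_congr rfl fun ν _ => h1 ν.1 ν.2]
  simp

/-- Stated separately from `smul_inv'`, which does not unify here with the instances on `E →* ℂˣ`. -/
theorem smul_inv_monoidHom {E : Subgroup G} [E.Normal] (c : (ConjAct G)ᵈᵐᵃ) (μ : E →* ℂˣ) :
    c • μ⁻¹ = (c • μ)⁻¹ := rfl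

/-- The invariants of the normal subgroup `E` form a proper `G`-invariant subspace. -/
theorem weightSpace_one_eq_bot [A.IsIrreducible] (h : ∃ e ∈ E, A e ≠ 1) :
    weightSpace (A.comp E.subtype) 1 = ⊥ := by
  by_contra hne
  obtain ⟨e, he, hA⟩ := h
  have htop := eq_top_of_forall_apply_mem (A := A) hne fun g v hv => by
    have h := apply_mem_weightSpace_smul (DomMulAct.mk (ConjAct.toConjAct g⁻¹)) hv
    have h1 : DomMulAct.mk (ConjAct.toConjAct g⁻¹) • (1 : E →* ℂˣ) = 1 := rfl
    rw [h1] at h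
    simpa using h
  refine hA (LinearMap.ext fun v => ?_)
  have hv : v ∈ weightSpace (A.comp E.subtype) 1 := htop ▸ Submodule.mem_top
  simpa using hv ⟨e, he⟩

end Clifford

/-! ### Orbits of linear characters in odd order -/

theorem eq_one_of_sq_eq_one_of_pow_odd {M : Type*} [Monoid M] {x : M} {k : ℕ} (hk : Odd k)
    (hx : x ^ 2 = 1) (hxk : x ^ k = 1) : x = 1 := by
  obtain ⟨j, rfl⟩ := hk
  rwa [pow_succ, pow_mul, hx, one_pow, one_mul] at hxk

/-- In a group of odd order no nontrivial linear character of `E` is conjugate to its inverse: an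
element exchanging the two has a square that fixes `μ`, and, being a power of that square, fixes `μ`
itself. -/
theorem eq_one_of_inv_mem_orbit {G : Type*} [Group G] [Finite G] (hodd : Odd (Nat.card G))
    {E : Subgroup G} [E.Normal] {μ : E →* ℂˣ}
    (h : μ⁻¹ ∈ MulAction.orbit (ConjAct G)ᵈᵐᵃ μ) : μ = 1 := by
  obtain ⟨c, hc⟩ := h
  change c • μ = μ⁻¹ at hc
  obtain ⟨k, hk⟩ := hodd
  have hcard : Nat.card (ConjAct G)ᵈᵐᵃ = Nat.card G :=
    (Nat.card_congr (ConjAct.toConjAct.toEquiv.trans DomMulAct.mk)).symm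
  have h2 : c ^ 2 ∈ MulAction.stabilizer (ConjAct G)ᵈᵐᵃ μ := by
    rw [MulAction.mem_stabilizer_iff, pow_two, mul_smul, hc, smul_inv_monoidHom, hc]
    exact inv_inv μ
  have hc' : c ∈ MulAction.stabilizer (ConjAct G)ᵈᵐᵃ μ := by
    have h3 : (c ^ 2) ^ (k + 1) = c := by
      rw [← pow_mul, show 2 * (k + 1) = Nat.card (ConjAct G)ᵈᵐᵃ + 1 by rw [hcard, hk]; ring,
        pow_succ, pow_card_eq_one', one_mul]
    rw [← h3]
    exact pow_mem h2 _
  rw [MulAction.mem_stabilizer_iff, hc] at hc'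
  refine MonoidHom.ext fun e => eq_one_of_sq_eq_one_of_pow_odd ⟨k, hk⟩ ?_ ?_
  · have := DFunLike.congr_fun hc' e
    rw [MonoidHom.inv_apply, inv_eq_iff_mul_eq_one] at this
    rw [pow_two, this]
  · have he : e ^ Nat.card G = 1 := Subtype.ext (by simp)
    rw [← map_pow, he, map_one]

theorem ncard_orbit_inv {G : Type*} [Group G] {E : Subgroup G} [E.Normal] (μ : E →* ℂˣ) :
    (MulAction.orbit (ConjAct G)ᵈᵐᵃ μ⁻¹).ncard = (MulAction.orbit (ConjAct G)ᵈᵐᵃ μ).ncard := by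
  have : MulAction.orbit (ConjAct G)ᵈᵐᵃ μ⁻¹ = (MulAction.orbit (ConjAct G)ᵈᵐᵃ μ)⁻¹ := by
    ext y
    simp only [MulAction.mem_orbit_iff, Set.mem_inv, smul_inv_monoidHom]
    exact exists_congr fun c =>
      ⟨fun h => by rw [← h]; exact (inv_inv (c • μ)).symm, fun h => by rw [h]; exact inv_inv y⟩
  rw [this, Set.ncard_inv]

theorem odd_ncard_orbit {G : Type*} [Group G] [Finite G] (hodd : Odd (Nat.card G))
    {E : Subgroup G} [E.Normal] (μ : E →* ℂˣ) :
    Odd (MulAction.orbit (ConjAct G)ᵈᵐᵃ μ).ncard := by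
  refine hodd.of_dvd_nat ?_
  rw [← MulAction.index_stabilizer,
    Nat.card_congr (ConjAct.toConjAct.toEquiv.trans DomMulAct.mk : G ≃ (ConjAct G)ᵈᵐᵃ)]
  exact Subgroup.index_dvd_card _

/-! ### Counting weights -/

/-- The contradiction for `G` of odd order, given a normal subgroup `E` that acts through commuting
operators on both constituents and nontrivially on the first. -/
theorem false_of_odd_card {G V W₁ W₂ : Type*} [Group G] [Finite G] (hodd : Odd (Nat.card G))
    [AddCommGroup V] [Module ℂ V] [FiniteDimensional ℂ V]
    [AddCommGroup W₁] [Module ℂ W₁] [FiniteDimensional ℂ W₁]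
    [AddCommGroup W₂] [Module ℂ W₂] [FiniteDimensional ℂ W₂]
    (ρ : Representation ℂ G V) (A₁ : Representation ℂ G W₁) (A₂ : Representation ℂ G W₂)
    [A₁.IsIrreducible] [A₂.IsIrreducible] {m₁ m₂ : ℕ} (hm₁ : 0 < m₁) (hm₂ : 0 < m₂)
    (hdec : ∀ g, ρ.character g⁻¹ * ρ.character g =
      1 + (m₁ : ℂ) * A₁.character g + (m₂ : ℂ) * A₂.character g)
    {E : Subgroup G} [E.Normal] (hE₁ : ∀ x y : E, Commute (A₁ x) (A₁ y))
    (hE₂ : ∀ x y : E, Commute (A₂ x) (A₂ y)) (hE : ∃ e ∈ E, A₁ e ≠ 1) : False := by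
  have := Fintype.ofFinite E
  let ρE : Representation ℂ E V := ρ.comp E.subtype
  -- weight multiplicities in the two constituents and in `End V`
  let a : (E →* ℂˣ) → ℕ := fun μ => finrank ℂ (weightSpace (A₁.comp E.subtype) μ)
  let b : (E →* ℂˣ) → ℕ := fun μ => finrank ℂ (weightSpace (A₂.comp E.subtype) μ)
  let c : (E →* ℂˣ) → ℕ := fun μ => finrank ℂ (weightSpace (linHom ρE ρE) μ)
  have hcardE : (Nat.card E : ℂ)⁻¹ * Nat.card E = 1 := inv_mul_cancel₀ (by simp)
  have hchar : ∀ e : E, (linHom ρE ρE).character e =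
      1 + (m₁ : ℂ) * character (A₁.comp E.subtype) e +
        (m₂ : ℂ) * character (A₂.comp E.subtype) e := fun e => by
    rw [char_linHom]
    exact hdec e
  have hc_aux : ∀ μ, (c μ : ℂ) = (Nat.card E : ℂ)⁻¹ * ∑ e, ((μ⁻¹ e : ℂˣ) : ℂ) +
      m₁ * a μ + m₂ * b μ := by
    intro μ
    simp only [a, b, c]
    simp only [finrank_weightSpace, hchar, Finset.mul_sum, ← Finset.sum_add_distrib]
    refine Finset.sum_congr rfl fun e _ => ?_
    ring
  have hc_ne : ∀ μ, μ ≠ 1 → c μ = m₁ * a μ + m₂ * b μ := by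
    intro μ hμ
    have hμ' : (Units.coeHom ℂ).comp μ⁻¹ ≠ 1 := by
      intro h
      apply hμ
      ext e
      have := DFunLike.congr_fun h e
      simpa using this
    have := hc_aux μ
    rw [show ∑ e, ((μ⁻¹ e : ℂˣ) : ℂ) = 0 from sum_hom_units_eq_zero _ hμ'] at this
    rw [mul_zero, zero_add] at this
    exact_mod_cast this
  have hc_one : c 1 = 1 + m₁ * a 1 + m₂ * b 1 := by
    have := hc_aux 1
    rw [show ∑ e : E, (((1 : E →* ℂˣ)⁻¹ e : ℂˣ) : ℂ) = Nat.card E by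
      simp [Nat.card_eq_fintype_card], hcardE] at this
    exact_mod_cast this
  -- the character of `End V` takes the same value at `e` and `e⁻¹`
  have hc_inv : ∀ μ, c μ⁻¹ = c μ := by
    intro μ
    have : (c μ⁻¹ : ℂ) = c μ := by
      simp only [c]
      rw [finrank_weightSpace, finrank_weightSpace]
      congr 1
      refine Fintype.sum_equiv (Equiv.inv E) _ _ fun e => ?_
      rw [char_linHom, char_linHom, Equiv.inv_apply, inv_inv e, mul_comm (ρE.character _),
        MonoidHom.inv_apply, map_inv μ⁻¹]
    exact_mod_cast this
  have ha_one : a 1 = 0 := by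
    simp only [a]
    rw [weightSpace_one_eq_bot hE, finrank_bot]
  have hnontriv : Nontrivial W₁ := by
    obtain ⟨e, -, he⟩ := hE
    by_contra h
    rw [not_nontrivial_iff_subsingleton] at h
    exact he (Subsingleton.elim _ _)
  have ha_pos : ∀ {μ}, weightSpace (A₁.comp E.subtype) μ ≠ ⊥ ↔ 0 < a μ := fun {μ} => by
    rw [Nat.pos_iff_ne_zero, Ne, Ne, Submodule.finrank_eq_zero]
  have hb_pos : ∀ {μ}, weightSpace (A₂.comp E.subtype) μ ≠ ⊥ ↔ 0 < b μ := fun {μ} => by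
    rw [Nat.pos_iff_ne_zero, Ne, Ne, Submodule.finrank_eq_zero]
  obtain ⟨μ, hμ⟩ := exists_weightSpace_ne_bot (σ := A₁.comp E.subtype) hE₁
  have haμ := ha_pos.mp hμ
  have hμ1 : μ ≠ 1 := by
    rintro rfl
    omega
  have hμ1' : μ⁻¹ ≠ 1 := fun h => hμ1 (by rw [← inv_inv μ, h]; rfl)
  have ha_inv : a μ⁻¹ = 0 := by
    by_contra h
    exact hμ1 (eq_one_of_inv_mem_orbit hodd
      (mem_orbit_of_weightSpace_ne_bot hE₁ hμ (ha_pos.mpr (Nat.pos_of_ne_zero h))))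
  have hcμ : 0 < c μ := by
    rw [hc_ne μ hμ1]
    positivity
  -- the weight `μ⁻¹` occurs in `End V` but not in the first constituent, so it occurs in the second
  have hbμ : 0 < b μ⁻¹ := by
    rw [← hc_inv, hc_ne _ hμ1', ha_inv, mul_zero, zero_add] at hcμ
    exact pos_of_mul_pos_right hcμ (Nat.zero_le _)
  have hμ₂ := hb_pos.mpr hbμ
  -- hence `E` acts without fixed vectors on the second constituent too
  have hb_one : b 1 = 0 := by
    by_contra h
    obtain ⟨d, hd⟩ := mem_orbit_of_weightSpace_ne_bot hE₂ (hb_pos.mpr (Nat.pos_of_ne_zero h)) hμ₂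
    exact hμ1' (hd.symm.trans rfl)
  have hc1 : ∀ ν, c ν ≤ 1 := fun ν =>
    finrank_weightSpace_linHom_le_one (by simpa [ha_one, hb_one] using hc_one) ν
  have hab : ∀ ν, m₁ * a ν + m₂ * b ν ≤ 1 := by
    intro ν
    by_cases hν : ν = 1
    · rw [hν, ha_one, hb_one]
      simp
    · rw [← hc_ne ν hν]
      exact hc1 ν
  have ha_le : ∀ ν, a ν ≤ 1 := fun ν => by nlinarith [hab ν]
  have hb_le : ∀ ν, b ν ≤ 1 := fun ν => by nlinarith [hab ν]
  have hm₁' : m₁ = 1 := by nlinarith [hab μ]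
  have hm₂' : m₂ = 1 := by nlinarith [hab μ⁻¹]
  have hW₁ := finrank_eq_ncard_orbit hE₁ hμ fun ν hν => le_antisymm (ha_le ν)
    (ha_pos.mp (weightSpace_ne_bot_of_mem_orbit hμ hν))
  have hW₂ := finrank_eq_ncard_orbit hE₂ hμ₂ fun ν hν => le_antisymm (hb_le ν)
    (hb_pos.mp (weightSpace_ne_bot_of_mem_orbit hμ₂ hν))
  rw [ncard_orbit_inv] at hW₂
  have hdim : finrank ℂ V * finrank ℂ V = 1 + finrank ℂ W₁ + finrank ℂ W₂ := by
    have := hdec 1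
    rw [inv_one, char_one, char_one, char_one, hm₁', hm₂'] at this
    rw [Nat.cast_one, one_mul, one_mul] at this
    exact_mod_cast this
  obtain ⟨k, hk⟩ := odd_ncard_orbit hodd μ
  rw [hW₁, hW₂, hk] at hdim
  -- `1 + 2 * (2 * k + 1)` is `3` modulo `4`, hence not a square
  have hmod := congrArg (· % 4) hdim
  have h4 : finrank ℂ V % 4 < 4 := Nat.mod_lt _ (by norm_num)
  simp only [Nat.mul_mod (finrank ℂ V)] at hmod
  interval_cases finrank ℂ V % 4 <;> omega

/-! ### A normal subgroup acting through commuting operators -/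

/-- The last term of the derived series that is not contained in `K` has its commutator subgroup
inside `K`. -/
theorem exists_normal_commutator_le {G : Type*} [Group G] [Group.IsSolvable G] {K : Subgroup G}
    (hK : K ≠ ⊤) : ∃ E : Subgroup G, E.Normal ∧ ¬ E ≤ K ∧ ⁅E, E⁆ ≤ K := by
  classical
  have hex : ∃ k, derivedSeries G k ≤ K := by
    obtain ⟨k, hk⟩ := Group.IsSolvable.solvable (G := G)
    exact ⟨k, hk ▸ bot_le⟩
  obtain ⟨j, hj⟩ : ∃ j, Nat.find hex = j + 1 := by
    refine Nat.exists_eq_succ_of_ne_zero fun h => hK ?_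
    have := Nat.find_spec hex
    rwa [h, derivedSeries_zero, top_le_iff] at this
  refine ⟨derivedSeries G j, derivedSeries_normal G j, Nat.find_min hex (by omega), ?_⟩
  have := Nat.find_spec hex
  rwa [hj, derivedSeries_succ] at this

theorem ker_ne_top_of_character_ne_one {G W : Type*} [Group G] [AddCommGroup W] [Module ℂ W]
    [FiniteDimensional ℂ W] (A : Representation ℂ G W) [A.IsIrreducible]
    (h : A.character ≠ fun _ => 1) : MonoidHom.ker A ≠ ⊤ := by
  intro hker
  have hA : ∀ g, A g = 1 := fun g => MonoidHom.mem_ker.mp (hker ▸ Subgroup.mem_top g)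
  have hnt : Nontrivial W := by
    by_contra hn
    rw [not_nontrivial_iff_subsingleton] at hn
    exact bot_ne_top (α := Subrepresentation A)
      (Subrepresentation.toSubmodule_injective (Subsingleton.elim _ _))
  obtain ⟨v, hv⟩ := exists_ne (0 : W)
  have htop : Submodule.span ℂ {v} = ⊤ :=
    eq_top_of_forall_apply_mem (A := A) (by simpa using hv) fun g w hw => by
      rw [hA]
      exact hw
  have hdim : finrank ℂ W = 1 := by
    rw [← finrank_top, ← htop, finrank_span_singleton hv]
  refine h (funext fun g => ?_)
  rw [character, hA, LinearMap.trace_one, hdim, Nat.cast_one]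

theorem commute_of_commutator_le_ker {G M : Type*} [Group G] [Monoid M] {f : G →* M}
    {E : Subgroup G} (hE : ⁅E, E⁆ ≤ f.ker) (x y : E) : Commute (f x) (f y) := by
  have h := MonoidHom.mem_ker.mp (hE (Subgroup.commutator_mem_commutator x.2 y.2))
  rw [commutatorElement_def] at h
  calc f x * f y = f (x * y * (x : G)⁻¹ * (y : G)⁻¹) * f (y * x) := by
        rw [← map_mul, ← map_mul]
        congr 1
        group
    _ = f y * f x := by rw [h, one_mul, map_mul]

theorem mainTheorem11 {G : Type*} [Group G] [Finite G] [Group.IsSolvable G]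
    (χ α₁ α₂ : G → ℂ) (hχ : χ ∈ Irr G) (hfaithful : IsFaithfulChar χ)
    (hα₁ : α₁ ∈ Irr G) (hα₂ : α₂ ∈ Irr G)
    (hα₁_ne : α₁ ≠ fun _ => 1) (hα₂_ne : α₂ ≠ fun _ => 1)
    (m₁ m₂ : ℕ) (hm₁ : 0 < m₁) (hm₂ : 0 < m₂)
    (hdecomp : ∀ g : G,
      χ g * (starRingEnd ℂ) (χ g) = 1 + (m₁ : ℂ) * α₁ g + (m₂ : ℂ) * α₂ g) :
    Even (Nat.card G) := by
  obtain ⟨n, ρ, -, rfl⟩ := hχ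
  obtain ⟨d₁, A₁, hA₁, rfl⟩ := hα₁
  obtain ⟨d₂, A₂, hA₂, rfl⟩ := hα₂
  by_contra hodd
  rw [Nat.not_even_iff_odd] at hodd
  have hdec : ∀ g, ρ.character g⁻¹ * ρ.character g =
      1 + (m₁ : ℂ) * A₁.character g + (m₂ : ℂ) * A₂.character g := fun g => by
    rw [character_inv_eq_conj, mul_comm, hdecomp]
  have hK : MonoidHom.ker A₁ ⊓ MonoidHom.ker A₂ ≠ ⊤ := fun h =>
    ker_ne_top_of_character_ne_one A₁ hα₁_ne (top_le_iff.mp (h ▸ inf_le_left))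
  obtain ⟨E, hEn, hEK, hEc⟩ := exists_normal_commutator_le hK
  have hE₁ := commute_of_commutator_le_ker (hEc.trans inf_le_left)
  have hE₂ := commute_of_commutator_le_ker (hEc.trans inf_le_right)
  obtain ⟨e, he, heK⟩ := SetLike.not_le_iff_exists.mp hEK
  rw [Subgroup.mem_inf, MonoidHom.mem_ker, MonoidHom.mem_ker, not_and_or] at heK
  rcases heK with h | h
  · exact false_of_odd_card hodd ρ A₁ A₂ hm₁ hm₂ hdec hE₁ hE₂ ⟨e, he, h⟩
  · exact false_of_odd_card hodd ρ A₂ A₁ hm₂ hm₁ (fun g => by rw [hdec g]; ring) hE₂ hE₁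
      ⟨e, he, h⟩
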